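/- A spacetime $(M,g)$ is a connected, Hausdorff, second countable, time-oriented manifold (without boundary, of finite dimension, smooth or at least $C^3$) with a Lorentzian metric $g$ of signature $(-,+,\dots,+)$ and of class $C^{1,1}$ (this includes $C^2$ metrics). Write $p\le q$ if $p=q$ or there is a future-directed (piecewise $C^1$) causal curve from $p$ to $q$. For $A\subset M$ let $J^+(A)=\{q : p\le q \text{ for some } p\in A\}$ and $J^-(A)=\{p : p\le q\text{ for some } q\in A\}$, and write $J^\pm(p)=J^\pm(\{p\})$. The causally convex hull of $A$ is $J^+(A)\cap J^-(A)$. The spacetime is causal if there is no closed causal curve; it is globally hyperbolic if it is causal and $J^+(p)\cap J^-(q)$ is compact for all $p,q\in M$; it is causally simple if it is causal and $J^+(p)$ and $J^-(p)$ are closed for every $p\in M$. Proposition. Let $(M,g)$ be a spacetime. 1. $(M,g)$ is globally hyperbolic if and only if it is causal and the causally convex hull of every compact subset of $M$ is compact. 2. $(M,g)$ is causally simple if and only if it is causal and the causally convex hull of every compact subset of $M$ is closed. -/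

import Mathlib

open Set
open scoped Manifold ContDiff Topology

/-- The component `y ↦ g(v, w)` of a field `g` of bilinear forms on the tangent spaces of `M`, in
the preferred chart around `x₀`, for constant coordinate vectors `v` and `w`: both are carried to
the tangent space of `M` by the differential of the inverse chart. -/
noncomputable def chartComponent {E : Type*} [NormedAddCommGroup E] [NormedSpace ℝ E]
    {M : Type*} [TopologicalSpace M] [ChartedSpace E M]
    (g : ∀ x : M, TangentSpace 𝓘(ℝ, E) x →L[ℝ] TangentSpace 𝓘(ℝ, E) x →L[ℝ] ℝ)
    (x₀ : M) (v w : E) (y : E) : ℝ :=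
  g ((extChartAt 𝓘(ℝ, E) x₀).symm y)
    (mfderiv 𝓘(ℝ, E) 𝓘(ℝ, E) (extChartAt 𝓘(ℝ, E) x₀).symm y v)
    (mfderiv 𝓘(ℝ, E) 𝓘(ℝ, E) (extChartAt 𝓘(ℝ, E) x₀).symm y w)

/-- A field of bilinear forms on the tangent spaces of `M` is of class `C^{1,1}`: its components in
charts are continuously differentiable, with locally Lipschitz first derivatives. -/
def IsC11 {E : Type*} [NormedAddCommGroup E] [NormedSpace ℝ E]
    {M : Type*} [TopologicalSpace M] [ChartedSpace E M]
    (g : ∀ x : M, TangentSpace 𝓘(ℝ, E) x →L[ℝ] TangentSpace 𝓘(ℝ, E) x →L[ℝ] ℝ) : Prop :=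
  ∀ (x₀ : M) (v w : E),
    ContDiffOn ℝ 1 (chartComponent g x₀ v w) (extChartAt 𝓘(ℝ, E) x₀).target ∧
    LocallyLipschitzOn (extChartAt 𝓘(ℝ, E) x₀).target (fderiv ℝ (chartComponent g x₀ v w))

/-- A bilinear form on a real vector space is Lorentzian if in some basis `b 0, …, b n` it is
`diag(-1, 1, …, 1)`. -/
def IsLorentzForm {V : Type*} [AddCommGroup V] [Module ℝ V] [TopologicalSpace V]
    (B : V →L[ℝ] V →L[ℝ] ℝ) : Prop :=
  ∃ (n : ℕ) (b : Module.Basis (Fin (n + 1)) ℝ V), ∀ i j : Fin (n + 1),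
    B (b i) (b j) = if i = j then (if i = 0 then -1 else 1) else 0

/-- A time-oriented Lorentzian structure on a manifold `M` modelled on `E`: a Lorentzian metric of
class `C^{1,1}` and a continuous timelike vector field that gives the time orientation. -/
structure TimeOrientedLorentz (E : Type*) [NormedAddCommGroup E] [NormedSpace ℝ E]
    (M : Type*) [TopologicalSpace M] [ChartedSpace E M] [IsManifold 𝓘(ℝ, E) 3 M] where
  /-- The metric. -/
  metric : ∀ x : M, TangentSpace 𝓘(ℝ, E) x →L[ℝ] TangentSpace 𝓘(ℝ, E) x →L[ℝ] ℝ
  /-- The metric has signature `(-, +, …, +)` at every point (in particular it is symmetric). -/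
  lorentz : ∀ x : M, IsLorentzForm (metric x)
  /-- The metric is of class `C^{1,1}`. -/
  regular : IsC11 metric
  /-- The vector field that gives the time orientation. -/
  timeField : ∀ x : M, TangentSpace 𝓘(ℝ, E) x
  timeField_continuous :
    Continuous fun x : M => (⟨x, timeField x⟩ : TangentBundle 𝓘(ℝ, E) M)
  timeField_timelike : ∀ x : M, metric x (timeField x) (timeField x) < 0

namespace TimeOrientedLorentz

variable {E : Type*} [NormedAddCommGroup E] [NormedSpace ℝ E]
  {M : Type*} [TopologicalSpace M] [ChartedSpace E M] [IsManifold 𝓘(ℝ, E) 3 M]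
  (S : TimeOrientedLorentz E M)

/-- Future-directed causal vectors: nonzero vectors `v` with `g(v, v) ≤ 0` that lie in the same half
of the causal cone as the time-orienting field `T`, that is, `g(v, T) < 0`. -/
def FutureCausal (x : M) (v : TangentSpace 𝓘(ℝ, E) x) : Prop :=
  v ≠ 0 ∧ S.metric x v v ≤ 0 ∧ S.metric x v (S.timeField x) < 0

/-- `γ` is a continuously differentiable future-directed causal curve on the interval `[a, b]`,
one-sided derivatives being taken at the endpoints. -/
def IsC1CausalOn (γ : ℝ → M) (a b : ℝ) : Prop :=
  a < b ∧ ContMDiffOn 𝓘(ℝ, ℝ) 𝓘(ℝ, E) 1 γ (Icc a b) ∧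
    ∀ t ∈ Icc a b,
      S.FutureCausal (γ t) (mfderivWithin 𝓘(ℝ, ℝ) 𝓘(ℝ, E) γ (Icc a b) t (1 : ℝ))

/-- `γ` is a piecewise continuously differentiable future-directed causal curve on `[a, b]`: there
is a subdivision `a = t 0 < t 1 < ⋯ < t N = b`, with `N ≥ 1`, such that `γ` is a continuously
differentiable future-directed causal curve on each `[t i, t (i + 1)]`. -/
def IsCausalCurve (γ : ℝ → M) (a b : ℝ) : Prop :=
  ∃ (N : ℕ) (t : ℕ → ℝ), 1 ≤ N ∧ t 0 = a ∧ t N = b ∧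
    ∀ i < N, S.IsC1CausalOn γ (t i) (t (i + 1))

/-- `p < q`: some future-directed causal curve goes from `p` to `q`. -/
def CausalLT (p q : M) : Prop :=
  ∃ (γ : ℝ → M) (a b : ℝ), S.IsCausalCurve γ a b ∧ γ a = p ∧ γ b = q

/-- The causal relation `J`: `p ≤ q` if `p < q` or `p = q`. -/
def CausalLE (p q : M) : Prop := S.CausalLT p q ∨ p = q

/-- The causal future `J⁺(A)` of a set. -/
def causalFuture (A : Set M) : Set M := {q | ∃ p ∈ A, S.CausalLE p q}

/-- The causal past `J⁻(A)` of a set. -/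
def causalPast (A : Set M) : Set M := {p | ∃ q ∈ A, S.CausalLE p q}

/-- The causally convex hull `J⁺(A) ∩ J⁻(A)` of a set. -/
def causallyConvexHull (A : Set M) : Set M := S.causalFuture A ∩ S.causalPast A

/-- Causality: there is no closed causal curve. -/
def IsCausal : Prop := ¬ ∃ (γ : ℝ → M) (a b : ℝ), S.IsCausalCurve γ a b ∧ γ a = γ b

/-- Global hyperbolicity: causality holds and all causal diamonds `J⁺(p) ∩ J⁻(q)` are compact. -/
def IsGloballyHyperbolic : Prop :=
  S.IsCausal ∧ ∀ p q : M, IsCompact (S.causalFuture {p} ∩ S.causalPast {q})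

/-- Causal simplicity: causality holds and all sets `J⁺(p)` and `J⁻(p)` are closed. -/
def IsCausallySimple : Prop :=
  S.IsCausal ∧ ∀ p : M, IsClosed (S.causalFuture {p}) ∧ IsClosed (S.causalPast {p})

end TimeOrientedLorentz

/-! Two facts carry the proof: `≤` is transitive (`CausalLE.trans`), and each neighbourhood of `x`
contains points `p`, `q` such that `J⁺(p)` and `J⁻(q)` are neighbourhoods of `x`
(`exists_mem_causalFuture_mem_nhds`). From hulls to diamonds: if `p ≤ q`, the diamond is the hull of
`{p, q}`; otherwise it is empty. Closed diamonds give closed `J⁺(p)` and `J⁻(p)`, since near a limit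
point `x` one may intersect with `J⁻(q)` or `J⁺(q)` for a suitable `q`. From diamonds to hulls: if
all `J^±(p)` are closed, so is the relation `≤`, and hence so is the hull of a compact set. A
compact set lies between two finite sets, so its hull lies in a finite union of diamonds, and is
compact when these are. -/

namespace TimeOrientedLorentz

/-! ### Local causality in a chart -/

section ChartComponents

variable {E : Type*} [NormedAddCommGroup E] [NormedSpace ℝ E]
  {M : Type*} [TopologicalSpace M] [ChartedSpace E M] [IsManifold 𝓘(ℝ, E) 3 M]
  (S : TimeOrientedLorentz E M)

/-- The metric pulled back to the model space by the preferred chart around `x₀`. -/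
noncomputable def chartMetric (x₀ : M) (y : E) : E →L[ℝ] E →L[ℝ] ℝ :=
  ContinuousLinearMap.bilinearComp (E := E) (F := E) (E' := E) (F' := E)
    (S.metric ((extChartAt 𝓘(ℝ, E) x₀).symm y))
    (mfderiv 𝓘(ℝ, E) 𝓘(ℝ, E) (extChartAt 𝓘(ℝ, E) x₀).symm y)
    (mfderiv 𝓘(ℝ, E) 𝓘(ℝ, E) (extChartAt 𝓘(ℝ, E) x₀).symm y)

/-- The time-orienting field in the preferred chart around `x₀`. -/
noncomputable def chartTimeField (x₀ : M) (y : E) : E :=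
  (trivializationAt E (TangentSpace 𝓘(ℝ, E)) x₀
    ⟨(extChartAt 𝓘(ℝ, E) x₀).symm y, S.timeField ((extChartAt 𝓘(ℝ, E) x₀).symm y)⟩).2

theorem continuousOn_chartMetric [FiniteDimensional ℝ E] (x₀ : M) :
    ContinuousOn (S.chartMetric x₀) (extChartAt 𝓘(ℝ, E) x₀).target := by
  rw [continuousOn_clm_apply]
  intro v
  rw [continuousOn_clm_apply]
  intro w
  exact (S.regular x₀ v w).1.continuousOn

theorem continuousOn_chartTimeField (x₀ : M) :
    ContinuousOn (S.chartTimeField x₀) (extChartAt 𝓘(ℝ, E) x₀).target := by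
  have : IsManifold 𝓘(ℝ, E) 1 M := IsManifold.of_le (n := 3) (by norm_num)
  have h : ContinuousOn (fun x : M => (trivializationAt E (TangentSpace 𝓘(ℝ, E)) x₀
      (⟨x, S.timeField x⟩ : TangentBundle 𝓘(ℝ, E) M)).2) (chartAt E x₀).source := by
    refine continuous_snd.comp_continuousOn
      ((trivializationAt E (TangentSpace 𝓘(ℝ, E)) x₀).continuousOn.comp
        S.timeField_continuous.continuousOn ?_)
    intro x hx
    exact (Bundle.Trivialization.mem_source _).2 hx
  refine h.comp (continuousOn_extChartAt_symm x₀) fun y hy => ?_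
  simpa using (extChartAt 𝓘(ℝ, E) x₀).map_target hy

/-- The tangent bundle trivialization is inverted, on each fibre, by the differential of the inverse
chart. -/
theorem mfderiv_chartTimeField (x₀ : M) {y : E} (hy : y ∈ (extChartAt 𝓘(ℝ, E) x₀).target) :
    mfderiv 𝓘(ℝ, E) 𝓘(ℝ, E) (extChartAt 𝓘(ℝ, E) x₀).symm y (S.chartTimeField x₀ y) =
      S.timeField ((extChartAt 𝓘(ℝ, E) x₀).symm y) := by
  have : IsManifold 𝓘(ℝ, E) 1 M := IsManifold.of_le (n := 3) (by norm_num)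
  have hx : (extChartAt 𝓘(ℝ, E) x₀).symm y ∈ (chartAt E x₀).source := by
    simpa using (extChartAt 𝓘(ℝ, E) x₀).map_target hy
  have h1 := TangentBundle.symmL_trivializationAt (I := 𝓘(ℝ, E)) hx
  rw [(extChartAt 𝓘(ℝ, E) x₀).right_inv hy] at h1
  have h2 := (trivializationAt E (TangentSpace 𝓘(ℝ, E)) x₀).symmL_continuousLinearMapAt (R := ℝ)
    (b := (extChartAt 𝓘(ℝ, E) x₀).symm y) hx
    (S.timeField ((extChartAt 𝓘(ℝ, E) x₀).symm y))
  rw [h1, Bundle.Trivialization.continuousLinearMapAt_apply,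
    Bundle.Trivialization.coe_linearMapAt_of_mem _ hx] at h2
  simpa [mfderivWithin_univ] using! h2

theorem chartMetric_chartTimeField (x₀ : M) {y : E} (hy : y ∈ (extChartAt 𝓘(ℝ, E) x₀).target)
    (v : E) :
    S.chartMetric x₀ y v (S.chartTimeField x₀ y) =
      S.metric ((extChartAt 𝓘(ℝ, E) x₀).symm y)
        (mfderiv 𝓘(ℝ, E) 𝓘(ℝ, E) (extChartAt 𝓘(ℝ, E) x₀).symm y v)
        (S.timeField ((extChartAt 𝓘(ℝ, E) x₀).symm y)) := by
  rw [← S.mfderiv_chartTimeField x₀ hy]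
  rfl

theorem chartMetric_timelike (x₀ : M) {y : E} (hy : y ∈ (extChartAt 𝓘(ℝ, E) x₀).target) :
    S.chartMetric x₀ y (S.chartTimeField x₀ y) (S.chartTimeField x₀ y) < 0 := by
  rw [S.chartMetric_chartTimeField x₀ hy, S.mfderiv_chartTimeField x₀ hy]
  exact S.timeField_timelike _

theorem futureCausal_of_chart (x₀ : M) {y : E} (hy : y ∈ (extChartAt 𝓘(ℝ, E) x₀).target) {v : E}
    (h1 : S.chartMetric x₀ y v v ≤ 0)
    (h2 : S.chartMetric x₀ y v (S.chartTimeField x₀ y) < 0) :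
    S.FutureCausal ((extChartAt 𝓘(ℝ, E) x₀).symm y)
      (mfderiv 𝓘(ℝ, E) 𝓘(ℝ, E) (extChartAt 𝓘(ℝ, E) x₀).symm y v) := by
  rw [S.chartMetric_chartTimeField x₀ hy] at h2
  refine ⟨fun h => ?_, h1, h2⟩
  rw [h, map_zero] at h2
  exact lt_irrefl _ h2

theorem FutureCausal.smul {S : TimeOrientedLorentz E M} {x : M} {v : TangentSpace 𝓘(ℝ, E) x}
    (h : S.FutureCausal x v) {c : ℝ} (hc : 0 < c) : S.FutureCausal x (c • v) := by
  obtain ⟨h0, h1, h2⟩ := h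
  refine ⟨smul_ne_zero hc.ne' h0, ?_, ?_⟩
  · simp only [map_smul, smul_apply, smul_eq_mul]
    exact mul_nonpos_of_nonneg_of_nonpos hc.le (mul_nonpos_of_nonneg_of_nonpos hc.le h1)
  · simp only [map_smul, smul_apply, smul_eq_mul]
    exact mul_neg_of_pos_of_neg hc h2

theorem IsC1CausalOn.isCausalCurve {S : TimeOrientedLorentz E M} {γ : ℝ → M} {a b : ℝ}
    (h : S.IsC1CausalOn γ a b) : S.IsCausalCurve γ a b :=
  ⟨1, fun i => if i = 0 then a else b, le_rfl, by simp, by simp, fun i hi => by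
    obtain rfl : i = 0 := by omega
    simpa using h⟩

/-- A segment in a chart whose direction is future-directed causal along the segment. -/
theorem causalLT_of_segment (x₀ : M) {y v : E} {c : ℝ} (hc : 0 < c)
    (ht : ∀ t ∈ Icc (0 : ℝ) 1, y + t • (c • v) ∈ (extChartAt 𝓘(ℝ, E) x₀).target)
    (h : ∀ t ∈ Icc (0 : ℝ) 1, S.FutureCausal ((extChartAt 𝓘(ℝ, E) x₀).symm (y + t • (c • v)))
      (mfderiv 𝓘(ℝ, E) 𝓘(ℝ, E) (extChartAt 𝓘(ℝ, E) x₀).symm (y + t • (c • v)) v)) :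
    S.CausalLT ((extChartAt 𝓘(ℝ, E) x₀).symm y)
      ((extChartAt 𝓘(ℝ, E) x₀).symm (y + c • v)) := by
  have : IsManifold 𝓘(ℝ, E) 1 M := IsManifold.of_le (n := 3) (by norm_num)
  set φ := extChartAt 𝓘(ℝ, E) x₀
  let l : ℝ → E := fun t => y + t • (c • v)
  have hφ : ContMDiffOn 𝓘(ℝ, E) 𝓘(ℝ, E) 1 φ.symm φ.target := contMDiffOn_extChartAt_symm x₀
  have hl : ContDiff ℝ 1 l := by fun_prop
  have hl' : ∀ t, HasDerivAt l (c • v) t := fun t => by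
    simpa only [one_smul] using! ((hasDerivAt_id t).smul_const (c • v)).const_add y
  refine ⟨φ.symm ∘ l, 0, 1, IsC1CausalOn.isCausalCurve ⟨one_pos, ?_, ?_⟩, ?_, ?_⟩
  · exact hφ.comp hl.contMDiff.contMDiffOn ht
  · intro t htm
    have hφt : MDifferentiableAt 𝓘(ℝ, E) 𝓘(ℝ, E) φ.symm (l t) :=
      ((hφ _ (ht t htm)).contMDiffAt ((isOpen_extChartAt_target x₀).mem_nhds (ht t htm)))
        |>.mdifferentiableAt one_ne_zero
    have hlt : MDifferentiableAt 𝓘(ℝ, ℝ) 𝓘(ℝ, E) l t :=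
      (hl' t).differentiableAt.mdifferentiableAt
    have hu : UniqueMDiffWithinAt 𝓘(ℝ, ℝ) (Icc (0 : ℝ) 1) t :=
      (uniqueDiffOn_Icc one_pos t htm).uniqueMDiffWithinAt
    have hlv : mfderiv 𝓘(ℝ, ℝ) 𝓘(ℝ, E) l t (1 : ℝ) = c • v := by
      rw [mfderiv_eq_fderiv]
      exact (fderiv_apply_one_eq_deriv (f := l) (x := t)).trans (hl' t).deriv
    have hcomp : mfderiv 𝓘(ℝ, ℝ) 𝓘(ℝ, E) (φ.symm ∘ l) t (1 : ℝ) =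
        c • mfderiv 𝓘(ℝ, E) 𝓘(ℝ, E) φ.symm (l t) v :=
      ((mfderiv_comp_apply t hφt hlt _).trans (congrArg _ hlv)).trans
        ((mfderiv 𝓘(ℝ, E) 𝓘(ℝ, E) φ.symm (l t)).map_smul c v)
    rw [mfderivWithin_eq_mfderiv hu (hφt.comp t hlt), hcomp]
    exact (h t htm).smul hc
  · simp [l]
  · simp [l]

/-- Around any point there are a coordinate ball and a cone of directions about the time-orienting
field that are causal throughout. -/
theorem exists_causal_cone [FiniteDimensional ℝ E] (x₀ : M) :
    ∃ r > 0, ∃ T : E, ∀ a ∈ Metric.ball (extChartAt 𝓘(ℝ, E) x₀ x₀) r,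
      ∀ b ∈ Metric.ball (extChartAt 𝓘(ℝ, E) x₀ x₀) r, ∀ v ∈ Metric.ball T r, ∀ c : ℝ, 0 < c →
      a + c • v = b →
      S.CausalLE ((extChartAt 𝓘(ℝ, E) x₀).symm a) ((extChartAt 𝓘(ℝ, E) x₀).symm b) := by
  set φ := extChartAt 𝓘(ℝ, E) x₀
  set y₀ := φ x₀
  have hopen : φ.target ∈ 𝓝 y₀ := extChartAt_target_mem_nhds x₀
  have hy₀ : y₀ ∈ φ.target := mem_of_mem_nhds hopen
  let T := S.chartTimeField x₀ y₀
  have hG : ContinuousAt (S.chartMetric x₀) y₀ :=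
    (S.continuousOn_chartMetric x₀).continuousAt hopen
  have hT : ContinuousAt (S.chartTimeField x₀) y₀ :=
    (S.continuousOn_chartTimeField x₀).continuousAt hopen
  have hG' : ContinuousAt (fun p : E × E => S.chartMetric x₀ p.1 p.2) (y₀, T) :=
    ContinuousAt.clm_apply (ContinuousAt.comp (g := S.chartMetric x₀) (f := Prod.fst)
      (x := (y₀, T)) hG continuousAt_fst) continuousAt_snd
  -- At `(y₀, T)` this condition and the next both say `g(T, T) < 0`; being strict, they persist
  -- nearby.
  have e1 : ∀ᶠ p : E × E in 𝓝 (y₀, T), S.chartMetric x₀ p.1 p.2 p.2 < 0 :=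
    (hG'.clm_apply continuousAt_snd).eventually_lt continuousAt_const
      (S.chartMetric_timelike x₀ hy₀)
  have e2 : ∀ᶠ p : E × E in 𝓝 (y₀, T),
      S.chartMetric x₀ p.1 p.2 (S.chartTimeField x₀ p.1) < 0 :=
    (hG'.clm_apply (ContinuousAt.comp (g := S.chartTimeField x₀) (f := Prod.fst)
      (x := (y₀, T)) hT continuousAt_fst)).eventually_lt continuousAt_const
      (S.chartMetric_timelike x₀ hy₀)
  have e3 : ∀ᶠ p : E × E in 𝓝 (y₀, T), p.1 ∈ φ.target := continuousAt_fst.eventually hopen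
  obtain ⟨r, hr, H⟩ := Metric.eventually_nhds_iff_ball.1 (e1.and (e2.and e3))
  refine ⟨r, hr, T, fun a ha b hb v hv c hc hab => Or.inl ?_⟩
  have hseg : ∀ t ∈ Icc (0 : ℝ) 1, a + t • (c • v) ∈ Metric.ball y₀ r := by
    intro t ht
    have : c • v = b - a := by rw [← hab]; abel
    rw [this]
    exact (convex_ball y₀ r).add_smul_sub_mem ha hb ht
  have hmem : ∀ t ∈ Icc (0 : ℝ) 1, (a + t • (c • v), v) ∈ Metric.ball (y₀, T) r := by
    intro t ht
    rw [← ball_prod_same]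
    exact ⟨hseg t ht, hv⟩
  rw [← hab]
  refine S.causalLT_of_segment x₀ hc (fun t ht => (H _ (hmem t ht)).2.2) fun t ht => ?_
  obtain ⟨h1, h2, h3⟩ := H _ (hmem t ht)
  exact S.futureCausal_of_chart x₀ h3 h1.le h2

/-- In the chart take `p = y₀ - εT`. A point `z` equals `p + ε(T + (z - y₀)/ε)`, and this direction
lies in the causal cone once `‖z - y₀‖ < εr`. For `q = y₀ + εT` the correction to `T` changes sign.
-/
theorem exists_mem_causalFuture_mem_nhds [FiniteDimensional ℝ E] (x : M) {U : Set M}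
    (hU : U ∈ 𝓝 x) :
    (∃ p ∈ U, S.causalFuture {p} ∈ 𝓝 x) ∧ ∃ q ∈ U, S.causalPast {q} ∈ 𝓝 x := by
  obtain ⟨r, hr, T, H⟩ := S.exists_causal_cone x
  set φ := extChartAt 𝓘(ℝ, E) x
  set y₀ := φ x
  have hline : ∀ σ : ℝ, ∀ᶠ ε : ℝ in 𝓝[>] 0,
      y₀ + (σ * ε) • T ∈ Metric.ball y₀ r ∧ φ.symm (y₀ + (σ * ε) • T) ∈ U := by
    intro σ
    have hc : Filter.Tendsto (fun ε : ℝ => y₀ + (σ * ε) • T) (𝓝[>] 0) (𝓝 y₀) := by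
      have : Continuous fun ε : ℝ => y₀ + (σ * ε) • T := by fun_prop
      simpa using (this.tendsto 0).mono_left nhdsWithin_le_nhds
    have hs : Filter.Tendsto φ.symm (𝓝 y₀) (𝓝 x) := by
      simpa [φ, y₀] using (continuousAt_extChartAt_symm (I := 𝓘(ℝ, E)) x).tendsto
    exact (hc.eventually (Metric.ball_mem_nhds y₀ hr)).and ((hs.comp hc).eventually hU)
  have hnear : ∀ ε > 0, ∀ᶠ z in 𝓝 x, z ∈ φ.source ∧ φ z ∈ Metric.ball y₀ r ∧
      φ z ∈ Metric.ball y₀ (ε * r) := by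
    intro ε hε
    have hφ : Filter.Tendsto φ (𝓝 x) (𝓝 y₀) := continuousAt_extChartAt x
    exact Filter.Eventually.and (extChartAt_source_mem_nhds x) ((hφ.eventually (Metric.ball_mem_nhds y₀ hr)).and
      (hφ.eventually (Metric.ball_mem_nhds y₀ (mul_pos hε hr))))
  have hdir : ∀ ε > 0, ∀ (σ : ℝ), |σ| = 1 → ∀ z ∈ Metric.ball y₀ (ε * r),
      T + (σ * ε⁻¹) • (z - y₀) ∈ Metric.ball T r := by
    intro ε hε σ hσ z hz
    rw [mem_ball_iff_norm] at hz ⊢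
    rw [add_sub_cancel_left, norm_smul, norm_mul, Real.norm_eq_abs, hσ, one_mul, norm_inv,
      Real.norm_of_nonneg hε.le, inv_mul_lt_iff₀ hε]
    exact hz
  constructor
  · obtain ⟨ε, ⟨hb, hu⟩, hε⟩ := ((hline (-1)).and self_mem_nhdsWithin).exists
    replace hε : 0 < ε := hε
    refine ⟨_, hu, ?_⟩
    filter_upwards [hnear ε hε] with z ⟨hz, hz1, hz2⟩
    refine ⟨_, rfl, ?_⟩
    rw [← φ.left_inv hz]
    refine H _ hb _ hz1 _ (hdir ε hε 1 (by simp) _ hz2) ε hε ?_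
    rw [smul_add, smul_smul, one_mul, mul_inv_cancel₀ hε.ne', neg_one_mul]
    module
  · obtain ⟨ε, ⟨hb, hu⟩, hε⟩ := ((hline 1).and self_mem_nhdsWithin).exists
    replace hε : 0 < ε := hε
    refine ⟨_, hu, ?_⟩
    filter_upwards [hnear ε hε] with z ⟨hz, hz1, hz2⟩
    refine ⟨_, rfl, ?_⟩
    rw [← φ.left_inv hz]
    refine H _ hz1 _ hb _ (hdir ε hε (-1) (by simp) _ hz2) ε hε ?_
    rw [smul_add, smul_smul, neg_one_mul, mul_neg, mul_inv_cancel₀ hε.ne', one_mul]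
    module

end ChartComponents

/-! ### Transitivity of the causal relation -/

section Concatenation

variable {E : Type*} [NormedAddCommGroup E] [NormedSpace ℝ E]
  {M : Type*} [TopologicalSpace M] [ChartedSpace E M] [IsManifold 𝓘(ℝ, E) 3 M]
  {S : TimeOrientedLorentz E M}

theorem IsC1CausalOn.congr {γ δ : ℝ → M} {a b : ℝ} (h : S.IsC1CausalOn γ a b)
    (hδ : EqOn δ γ (Icc a b)) : S.IsC1CausalOn δ a b := by
  obtain ⟨hab, h1, h2⟩ := h
  refine ⟨hab, h1.congr hδ, fun t ht => ?_⟩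
  -- The tangent space depends on the base point, so the equality `δ t = γ t` is used by
  -- substituting a variable.
  have key : ∀ x : M, γ t = x →
      S.FutureCausal x (mfderivWithin 𝓘(ℝ, ℝ) 𝓘(ℝ, E) γ (Icc a b) t (1 : ℝ)) := by
    rintro x rfl
    exact h2 t ht
  rw [mfderivWithin_congr_of_mem hδ ht]
  exact key _ (hδ ht).symm

theorem IsC1CausalOn.comp_add_right {γ : ℝ → M} {a b : ℝ} (h : S.IsC1CausalOn γ a b) (c : ℝ) :
    S.IsC1CausalOn (fun t => γ (t + c)) (a - c) (b - c) := by
  obtain ⟨hab, h1, h2⟩ := h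
  have hmaps : MapsTo (fun t : ℝ => t + c) (Icc (a - c) (b - c)) (Icc a b) := fun t ht =>
    ⟨by linarith [ht.1], by linarith [ht.2]⟩
  have hadd : ContDiff ℝ 1 (fun t : ℝ => t + c) := by fun_prop
  have hab' : a - c < b - c := by linarith
  refine ⟨hab', h1.comp hadd.contMDiff.contMDiffOn hmaps, fun t ht => ?_⟩
  have hu : UniqueMDiffWithinAt 𝓘(ℝ, ℝ) (Icc (a - c) (b - c)) t :=
    (uniqueDiffOn_Icc hab' t ht).uniqueMDiffWithinAt
  have hd : MDifferentiableWithinAt 𝓘(ℝ, ℝ) 𝓘(ℝ, ℝ) (fun t : ℝ => t + c)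
      (Icc (a - c) (b - c)) t :=
    (hadd.contMDiff.contMDiffOn (s := Icc (a - c) (b - c)) t ht).mdifferentiableWithinAt one_ne_zero
  have hγ := (h1 _ (hmaps ht)).mdifferentiableWithinAt one_ne_zero
  have h3 := mfderivWithin_comp (g := γ) t hγ hd hmaps.subset_preimage hu
  have h4 : mfderivWithin 𝓘(ℝ, ℝ) 𝓘(ℝ, ℝ) (fun t : ℝ => t + c) (Icc (a - c) (b - c)) t (1 : ℝ) =
      (1 : ℝ) := by
    rw [mfderivWithin_eq_fderivWithin, fderivWithin_add_const, fderivWithin_fun_id]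
    · rfl
    · exact uniqueDiffOn_Icc hab' t ht
  have h5 := h2 _ (hmaps ht)
  change S.FutureCausal (γ (t + c)) (mfderivWithin 𝓘(ℝ, ℝ) 𝓘(ℝ, E) (γ ∘ fun t : ℝ => t + c)
    (Icc (a - c) (b - c)) t (1 : ℝ))
  rw [h3]
  rw [← h4] at h5
  exact h5

theorem CausalLT.trans {p q r : M} (h : S.CausalLT p q) (h' : S.CausalLT q r) :
    S.CausalLT p r := by
  obtain ⟨γ, a, b, ⟨N, t, hN, h0, hb, ht⟩, rfl, hq⟩ := h
  obtain ⟨δ, a', b', ⟨N', t', hN', h0', hb', ht'⟩, hq', rfl⟩ := h'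
  have hmono : ∀ i j, i ≤ j → j ≤ N → t i ≤ t j := by
    intro i j hij
    induction j, hij using Nat.le_induction with
    | base => exact fun _ => le_rfl
    | succ j _ ih => exact fun hj => (ih (by omega)).trans (ht j (by omega)).1.le
  have hmono' : ∀ i j, i ≤ j → j ≤ N' → t' i ≤ t' j := by
    intro i j hij
    induction j, hij using Nat.le_induction with
    | base => exact fun _ => le_rfl
    | succ j _ ih => exact fun hj => (ih (by omega)).trans (ht' j (by omega)).1.le
  let η : ℝ → M := fun s => if s ≤ b then γ s else δ (s + (a' - b))
  have hη : ∀ s, b ≤ s → η s = δ (s + (a' - b)) := by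
    intro s hs
    rcases hs.eq_or_lt with rfl | hs
    · simp [η, hq, hq']
    · simp [η, hs.not_ge]
  have hηa : η a = γ a := if_pos (by rw [← h0, ← hb]; exact hmono 0 N (by omega) le_rfl)
  have hηb : η (b' - (a' - b)) = δ b' := by
    rw [hη, sub_add_cancel]
    have := hmono' 0 N' (by omega) le_rfl
    rw [h0', hb'] at this
    linarith
  refine ⟨η, a, b' - (a' - b), ⟨N + N', fun i => if i ≤ N then t i else t' (i - N) - (a' - b),
    by omega, by simpa using h0, ?_, ?_⟩, hηa, hηb⟩
  · simp [show ¬ N' = 0 by omega, hb']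
  · intro i hi
    rcases lt_or_ge i N with hiN | hiN
    · simp only [if_pos hiN.le, if_pos (show i + 1 ≤ N from hiN)]
      refine (ht i hiN).congr fun s hs => if_pos (hs.2.trans ?_)
      rw [← hb]
      exact hmono _ _ hiN le_rfl
    -- At `i = N` the two formulas agree, as `t N = b` and `t' 0 = a'`.
    · have h1 : (if i ≤ N then t i else t' (i - N) - (a' - b)) = t' (i - N) - (a' - b) := by
        split_ifs with h
        · obtain rfl : i = N := le_antisymm h hiN
          simp [hb, h0']
        · rfl
      simp only [h1, if_neg (show ¬ i + 1 ≤ N by omega)]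
      rw [show i + 1 - N = i - N + 1 by omega]
      refine ((ht' (i - N) (by omega)).comp_add_right (a' - b)).congr fun s hs => hη s ?_
      have := hmono' 0 (i - N) (by omega) (by omega)
      rw [h0'] at this
      linarith [hs.1]

theorem CausalLE.trans {p q r : M} (h : S.CausalLE p q) (h' : S.CausalLE q r) :
    S.CausalLE p r := by
  rcases h with h | rfl
  · rcases h' with h' | rfl
    · exact Or.inl (h.trans h')
    · exact Or.inl h
  · exact h'

/-- The causally convex hull of a pair of related points is their diamond. -/
theorem causallyConvexHull_pair {p q : M} (h : S.CausalLE p q) :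
    S.causallyConvexHull {p, q} = S.causalFuture {p} ∩ S.causalPast {q} := by
  ext x
  constructor
  · rintro ⟨⟨y, hy, hyx⟩, z, hz, hxz⟩
    have hpy : S.CausalLE p y := by
      rcases hy with rfl | rfl
      exacts [Or.inr rfl, h]
    have hzq : S.CausalLE z q := by
      rcases hz with rfl | rfl
      exacts [h, Or.inr rfl]
    exact ⟨⟨p, rfl, hpy.trans hyx⟩, q, rfl, hxz.trans hzq⟩
  · rintro ⟨⟨_, rfl, hp⟩, _, rfl, hq⟩
    exact ⟨⟨_, by simp, hp⟩, _, by simp, hq⟩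

end Concatenation

/-! ### Closedness and compactness of diamonds and hulls -/

section CausalLadder

variable {E : Type*} [NormedAddCommGroup E] [NormedSpace ℝ E]
  {M : Type*} [TopologicalSpace M] [ChartedSpace E M] [IsManifold 𝓘(ℝ, E) 3 M]
  {S : TimeOrientedLorentz E M}

theorem mem_causalFuture_singleton {p x : M} : x ∈ S.causalFuture {p} ↔ S.CausalLE p x := by
  simp [causalFuture]

theorem mem_causalPast_singleton {q x : M} : x ∈ S.causalPast {q} ↔ S.CausalLE x q := by
  simp [causalPast]

theorem diamond_eq_empty {p q : M} (h : ¬ S.CausalLE p q) :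
    S.causalFuture {p} ∩ S.causalPast {q} = ∅ := by
  refine eq_empty_of_forall_notMem fun x hx => h ?_
  exact (mem_causalFuture_singleton.1 hx.1).trans (mem_causalPast_singleton.1 hx.2)

/-- Closed causal diamonds force closed causal futures and pasts of points. -/
theorem isClosed_causalFuture_causalPast_of_diamond [FiniteDimensional ℝ E]
    (h : ∀ p q : M, IsClosed (S.causalFuture {p} ∩ S.causalPast {q})) (p : M) :
    IsClosed (S.causalFuture {p}) ∧ IsClosed (S.causalPast {p}) := by
  constructor
  · refine isClosed_of_closure_subset fun x hx => ?_
    -- Since `J⁻(q)` is a neighbourhood of `x`, points of `J⁺(p)` near `x` lie in the diamond of `p`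
    -- and `q`.
    obtain ⟨q, -, hq⟩ := (S.exists_mem_causalFuture_mem_nhds x Filter.univ_mem).2
    have : x ∈ closure (S.causalFuture {p} ∩ S.causalPast {q}) := by
      refine mem_closure_iff_nhds.2 fun U hU => ?_
      obtain ⟨y, ⟨hyU, hyq⟩, hyp⟩ := mem_closure_iff_nhds.1 hx _ (Filter.inter_mem hU hq)
      exact ⟨y, hyU, hyp, hyq⟩
    rw [(h p q).closure_eq] at this
    exact this.1
  · refine isClosed_of_closure_subset fun x hx => ?_
    obtain ⟨q, -, hq⟩ := (S.exists_mem_causalFuture_mem_nhds x Filter.univ_mem).1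
    have : x ∈ closure (S.causalPast {p} ∩ S.causalFuture {q}) := by
      refine mem_closure_iff_nhds.2 fun U hU => ?_
      obtain ⟨y, ⟨hyU, hyq⟩, hyp⟩ := mem_closure_iff_nhds.1 hx _ (Filter.inter_mem hU hq)
      exact ⟨y, hyU, hyp, hyq⟩
    rw [inter_comm, (h q p).closure_eq] at this
    exact this.2

/-- If the causal futures and pasts of points are closed, so is the causal relation. -/
theorem isClosed_causalLE [FiniteDimensional ℝ E]
    (h : ∀ p : M, IsClosed (S.causalFuture {p}) ∧ IsClosed (S.causalPast {p})) :
    IsClosed {x : M × M | S.CausalLE x.1 x.2} := by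
  refine isClosed_of_closure_subset ?_
  rintro ⟨p, q⟩ hpq
  refine mem_causalPast_singleton.1 ((h q).2.closure_subset ?_)
  rw [mem_closure_iff_nhds]
  intro U hU
  -- Pairs `x ≤ y` near `(p, q)` have `p' ≤ x ≤ y`, so `q` is a limit of points of the closed set
  -- `J⁺(p')`. Such `p'` exist arbitrarily near `p`.
  obtain ⟨p', hp'U, hp'⟩ := (S.exists_mem_causalFuture_mem_nhds p hU).1
  refine ⟨p', hp'U, mem_causalPast_singleton.2 (mem_causalFuture_singleton.1
    ((h p').1.closure_subset (mem_closure_iff_nhds.2 fun V hV => ?_)))⟩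
  obtain ⟨⟨x, y⟩, ⟨hx, hy⟩, hxy⟩ := mem_closure_iff_nhds.1 hpq _ (prod_mem_nhds hp' hV)
  exact ⟨y, hy, mem_causalFuture_singleton.2 ((mem_causalFuture_singleton.1 hx).trans hxy)⟩

/-- `J⁺(K)` is the projection to `M` of a closed subset of `K × M`, and projection along a compact
factor is a closed map; likewise `J⁻(K)`. -/
theorem isClosed_causallyConvexHull [FiniteDimensional ℝ E]
    (h : ∀ p : M, IsClosed (S.causalFuture {p}) ∧ IsClosed (S.causalPast {p})) {K : Set M}
    (hK : IsCompact K) : IsClosed (S.causallyConvexHull K) := by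
  have : CompactSpace K := isCompact_iff_compactSpace.1 hK
  have hJ := isClosed_causalLE h
  have hf : IsClosed (S.causalFuture K) := by
    have h1 : IsClosed {x : K × M | S.CausalLE x.1 x.2} :=
      hJ.preimage (f := fun x : K × M => ((x.1 : M), x.2)) (by fun_prop)
    convert! isClosedMap_snd_of_compactSpace _ h1 using 1
    ext x
    simp [causalFuture]
  have hp : IsClosed (S.causalPast K) := by
    have h1 : IsClosed {x : K × M | S.CausalLE x.2 x.1} :=
      hJ.preimage (f := fun x : K × M => (x.2, (x.1 : M))) (by fun_prop)
    convert! isClosedMap_snd_of_compactSpace _ h1 using 1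
    ext x
    simp [causalPast]
  exact hf.inter hp

/-- A compact set lies in the causal future, and in the causal past, of a finite set. -/
theorem exists_finite_causal_cover [FiniteDimensional ℝ E] (S : TimeOrientedLorentz E M)
    {K : Set M} (hK : IsCompact K) :
    ∃ A B : Set M, A.Finite ∧ B.Finite ∧ K ⊆ S.causalFuture A ∧ K ⊆ S.causalPast B := by
  choose! f hf using fun x : M => (S.exists_mem_causalFuture_mem_nhds x Filter.univ_mem).1
  choose! g hg using fun x : M => (S.exists_mem_causalFuture_mem_nhds x Filter.univ_mem).2
  obtain ⟨s, -, hs⟩ := hK.elim_nhds_subcover _ fun x _ => (hf x).2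
  obtain ⟨t, -, ht⟩ := hK.elim_nhds_subcover _ fun x _ => (hg x).2
  refine ⟨f '' s, g '' t, s.finite_toSet.image f, t.finite_toSet.image g, fun x hx => ?_,
    fun x hx => ?_⟩
  · obtain ⟨y, hy, hxy⟩ := mem_iUnion₂.1 (hs hx)
    exact ⟨f y, mem_image_of_mem f hy, mem_causalFuture_singleton.1 hxy⟩
  · obtain ⟨y, hy, hxy⟩ := mem_iUnion₂.1 (ht hx)
    exact ⟨g y, mem_image_of_mem g hy, mem_causalPast_singleton.1 hxy⟩

theorem exists_isCompact_causallyConvexHull_subset [FiniteDimensional ℝ E]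
    (h : ∀ p q : M, IsCompact (S.causalFuture {p} ∩ S.causalPast {q})) {K : Set M}
    (hK : IsCompact K) : ∃ C : Set M, IsCompact C ∧ S.causallyConvexHull K ⊆ C := by
  obtain ⟨A, B, hA, hB, hKA, hKB⟩ := S.exists_finite_causal_cover hK
  refine ⟨⋃ p ∈ A, ⋃ q ∈ B, S.causalFuture {p} ∩ S.causalPast {q},
    hA.isCompact_biUnion fun p _ => hB.isCompact_biUnion fun q _ => h p q, ?_⟩
  rintro x ⟨⟨y, hy, hyx⟩, z, hz, hxz⟩
  obtain ⟨p, hp, hpy⟩ := hKA hy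
  obtain ⟨q, hq, hzq⟩ := hKB hz
  exact mem_iUnion₂.2 ⟨p, hp, mem_iUnion₂.2 ⟨q, hq,
    mem_causalFuture_singleton.2 (hpy.trans hyx), mem_causalPast_singleton.2 (hxz.trans hzq)⟩⟩

end CausalLadder

end TimeOrientedLorentz

open TimeOrientedLorentz in
theorem proposition3 {E : Type*} [NormedAddCommGroup E] [NormedSpace ℝ E] [FiniteDimensional ℝ E]
    {M : Type*} [TopologicalSpace M] [T2Space M] [SecondCountableTopology M] [ConnectedSpace M]
    [ChartedSpace E M] [IsManifold 𝓘(ℝ, E) 3 M] (S : TimeOrientedLorentz E M) :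
    (S.IsGloballyHyperbolic ↔
      S.IsCausal ∧ ∀ K : Set M, IsCompact K → IsCompact (S.causallyConvexHull K)) ∧
    (S.IsCausallySimple ↔
      S.IsCausal ∧ ∀ K : Set M, IsCompact K → IsClosed (S.causallyConvexHull K)) := by
  have hpair : ∀ p q : M, IsCompact ({p, q} : Set M) := fun p q => (toFinite _).isCompact
  refine ⟨and_congr_right fun _ => ⟨fun h K hK => ?_, fun h p q => ?_⟩,
    and_congr_right fun _ => ⟨fun h K hK => isClosed_causallyConvexHull h hK, fun h => ?_⟩⟩
  · obtain ⟨C, hC, hsub⟩ := exists_isCompact_causallyConvexHull_subset h hK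
    -- Compact diamonds are closed because `M` is Hausdorff, so the hull is closed as well.
    exact hC.of_isClosed_subset (isClosed_causallyConvexHull
      (isClosed_causalFuture_causalPast_of_diamond fun p q => (h p q).isClosed) hK) hsub
  · by_cases hpq : S.CausalLE p q
    · rw [← causallyConvexHull_pair hpq]
      exact h _ (hpair p q)
    · rw [diamond_eq_empty hpq]
      exact isCompact_empty
  · refine isClosed_causalFuture_causalPast_of_diamond fun p q => ?_
    by_cases hpq : S.CausalLE p q
    · rw [← causallyConvexHull_pair hpq]
      exact h _ (hpair p q)
    · rw [diamond_eq_empty hpq]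
      exact isClosed_empty
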